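/- Let $S$ be a countable discrete group, written additively with neutral element $0$ (not necessarily commutative), and let $X=(X_t)_{t\ge 0}$ be a continuous-time random walk on $S$ started at $0$, i.e. an $S$-valued process with $X_0=0$ almost surely, stationary and independent increments $X_t-X_s$, and almost surely càdlàg paths (holding times of arbitrary rate are allowed). Write $p_t(x,y)=\mathbb P(X_t+x=y)$ for its transition probabilities and $T_t\varphi(x)=\mathbb E\,\varphi(X_t+x)$ for its semigroup. Assume that $X$ is recurrent, i.e. $\int_0^\infty T_t\varphi(x)\,dt=\infty$ for every $x\in S$ and every function $\varphi:S\to[0,\infty)$ of finite support that is not identically $0$ (in particular $X$ is irreducible), and that $$p_t(0,0)=o(t^{-1+\varepsilon})\quad\text{as } t\to\infty\quad\text{for every }\varepsilon>0 .$$ Let $H=\inf\{t>0: X_t\ne 0\}$ be the holding time at the origin and $T=\inf\{t>H: X_t=0\}$ the first return time to the origin (with $\inf\emptyset=\infty$). Then $T$ has no finite moments of positive order: $\mathbb E[T^\zeta]=\infty$ for every $\zeta>0$. -/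

import Mathlib

open MeasureTheory ProbabilityTheory Filter Topology Asymptotics
open scoped NNReal ENNReal

namespace GroupWalk

variable {Ω S : Type*} [MeasurableSpace Ω]

/-- A continuous-time random walk on a discrete group `S` (written additively) started at the
origin: a Lévy process, i.e. a process with `X 0 = 0`, independent and stationary increments and
càdlag paths. -/
structure IsRandomWalk [AddGroup S] [TopologicalSpace S] [MeasurableSpace S]
    (X : ℝ≥0 → Ω → S) (P : Measure Ω) : Prop where
  measurable : ∀ t, Measurable (X t)
  zero : ∀ᵐ ω ∂P, X 0 ω = 0
  indep_increments : HasIndepIncrements X P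
  stationary_increments : ∀ s t, IdentDistrib (fun ω => X (s + t) ω - X s ω) (X t) P P
  cadlag : ∀ᵐ ω ∂P, ∀ t, ContinuousWithinAt (fun s => X s ω) (Set.Ici t) t ∧
    ∃ l, Tendsto (fun s => X s ω) (𝓝[<] t) (𝓝 l)

/-- The transition probability `p_t(x, y)`; the walk started at `x` is `X t + x`. -/
noncomputable def transProb [AddGroup S] (X : ℝ≥0 → Ω → S) (P : Measure Ω)
    (t : ℝ≥0) (x y : S) : ℝ :=
  P.real {ω | X t ω + x = y}

/-- The semigroup `T_t φ(x) = 𝔼_x φ(X(t))` on nonnegative functions. -/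
noncomputable def semigroup [AddGroup S] (X : ℝ≥0 → Ω → S) (P : Measure Ω)
    (t : ℝ≥0) (φ : S → ℝ≥0) (x : S) : ℝ≥0∞ :=
  ∫⁻ ω, (φ (X t ω + x) : ℝ≥0∞) ∂P

/-- The Green operator `Gφ = ∫₀^∞ T_t φ dt` on nonnegative functions. -/
noncomputable def green [AddGroup S] (X : ℝ≥0 → Ω → S) (P : Measure Ω)
    (φ : S → ℝ≥0) (x : S) : ℝ≥0∞ :=
  ∫⁻ t in Set.Ioi (0 : ℝ), semigroup X P t.toNNReal φ x

/-- Recurrence: `Gφ ≡ ∞` for every nonnegative `φ ≠ 0` of bounded (that is, finite) support. As `G`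
is monotone, `Gφ ≡ ∞` then holds for every nonnegative `φ ≠ 0` whatsoever. -/
def IsRecurrent [AddGroup S] (X : ℝ≥0 → Ω → S) (P : Measure Ω) : Prop :=
  ∀ φ : S → ℝ≥0, (Function.support φ).Finite → φ ≠ 0 → ∀ x, green X P φ x = ∞

/-- The holding time `H = inf {t > 0 : X_t ≠ 0}` at the origin (`∞` if there is no such `t`). -/
noncomputable def holdingTime [Zero S] (X : ℝ≥0 → Ω → S) (ω : Ω) : ℝ≥0∞ :=
  ⨅ (t : ℝ≥0) (_ : 0 < t) (_ : X t ω ≠ 0), (t : ℝ≥0∞)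

/-- The first return time `T = inf {t > H : X_t = 0}` to the origin (`∞` if there is no
such `t`). -/
noncomputable def returnTime [Zero S] (X : ℝ≥0 → Ω → S) (ω : Ω) : ℝ≥0∞ :=
  ⨅ (t : ℝ≥0) (_ : holdingTime X ω < t) (_ : X t ω = 0), (t : ℝ≥0∞)

end GroupWalk

/-! Let `u(t) = P(X_t = 0)`, with Laplace transform `U(l)`. Decomposing at the first return gives
the renewal identity `U(l) (1 - E e^{-lT}) = E ∫_0^H e^{-lt} dt`. The right side is at least some `c
> 0` for all `0 < l ≤ 1`, because the walk rests at the origin for a while with positive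
probability. For `ζ ≤ 1`, `1 - e^{-x} ≤ x^ζ` yields `c ≤ l^ζ E[T^ζ] U(l)` (`laplace_holding_le`).
Decay with `ε = ζ/2` gives `U(l) = O(l^{-ζ/2})` as `l → 0` (`laplace_le_of_le_rpow`), so a finite
moment would force `c = O(l^{ζ/2})`, which is absurd.

Only the inequality `≥` in the renewal identity is needed, so the strong Markov property at `T` can
be avoided. First returns on a grid satisfy a renewal inequality by independence of increments
(`le_measure_eq_zero`), Fatou passes it to refining grids (`laplace_limitWeight_le`), and
right-continuity compares the limit with `T` (`one_le_limitWeight_add`). -/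

namespace GroupWalk

variable {Ω S : Type*} {X : ℝ≥0 → Ω → S}

/-! ### First returns of a sampled path -/

/-- A path sampled on the grid `h ℕ` sits at the origin at step `k` after having left it. -/
def HasReturned [Zero S] (Y : ℕ → S) (k : ℕ) : Prop :=
  Y k = 0 ∧ ∃ j < k, Y j ≠ 0

/-- Step `k` is the first return of the sampled path `Y` to the origin. -/
def IsFirstReturn [Zero S] (Y : ℕ → S) (k : ℕ) : Prop :=
  HasReturned Y k ∧ ∀ i < k, ¬ HasReturned Y i

/-- The event that the walk sampled on the grid `h ℕ` returns to the origin first at step `k`. -/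
def gridReturn [Zero S] (X : ℝ≥0 → Ω → S) (h : ℝ≥0) (k : ℕ) : Set Ω :=
  {ω | IsFirstReturn (fun j : ℕ => X (j * h) ω) k}

/-- The path with increments `D`, started at the origin. -/
def pathOfIncrements [AddGroup S] (D : ℕ → S) : ℕ → S
  | 0 => 0
  | j + 1 => D j + pathOfIncrements D j

lemma pathOfIncrements_sub [AddGroup S] (x : ℕ → S) (hx : x 0 = 0) :
    pathOfIncrements (fun i => x (i + 1) - x i) = x := by
  funext j
  induction j with
  | zero => simp [pathOfIncrements, hx]
  | succ j ih => simp [pathOfIncrements, ih]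

lemma isFirstReturn_congr [Zero S] {Y Z : ℕ → S} {k : ℕ} (h : ∀ j ≤ k, Y j = Z j) :
    IsFirstReturn Y k ↔ IsFirstReturn Z k := by
  have H : ∀ i ≤ k, HasReturned Y i ↔ HasReturned Z i := by
    intro i hi
    unfold HasReturned
    rw [h i hi]
    refine and_congr_right fun _ => exists_congr fun j => and_congr_right fun hj => ?_
    rw [h j (hj.le.trans hi)]
  unfold IsFirstReturn
  rw [H k le_rfl]
  exact and_congr_right fun _ => forall_congr' fun i =>
    ⟨fun hi hik => (H i hik.le).not.1 (hi hik), fun hi hik => (H i hik.le).not.2 (hi hik)⟩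

/-- The σ-algebra `m` is left free so that it can be the one generated by the increments before step
`k`. -/
lemma measurableSet_isFirstReturn [Zero S] [MeasurableSpace S] [DiscreteMeasurableSpace S]
    {m : MeasurableSpace Ω} {Y : ℕ → Ω → S} {k : ℕ} (hY : ∀ j ≤ k, Measurable[m] (Y j)) :
    MeasurableSet[m] {ω | IsFirstReturn (fun j => Y j ω) k} := by
  have h0 : ∀ j ≤ k, MeasurableSet[m] {ω | Y j ω = 0} := fun j hj =>
    hY j hj (MeasurableSet.of_discrete (s := {0}))
  have hR : ∀ i ≤ k, MeasurableSet[m] {ω | HasReturned (fun j => Y j ω) i} := by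
    intro i hi
    have : {ω | HasReturned (fun j => Y j ω) i} =
        {ω | Y i ω = 0} ∩ ⋃ j, ⋃ _ : j < i, {ω | Y j ω = 0}ᶜ := by
      ext ω; simp [HasReturned]
    rw [this]
    exact (h0 i hi).inter (MeasurableSet.iUnion fun j => MeasurableSet.iUnion fun hj =>
      (h0 j (hj.le.trans hi)).compl)
  have : {ω | IsFirstReturn (fun j => Y j ω) k} = {ω | HasReturned (fun j => Y j ω) k} ∩
      ⋂ i, ⋂ _ : i < k, {ω | HasReturned (fun j => Y j ω) i}ᶜ := by
    ext ω; simp [IsFirstReturn]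
  rw [this]
  exact (hR k le_rfl).inter (MeasurableSet.iInter fun j => MeasurableSet.iInter fun hj =>
      (hR j hj.le).compl)

lemma pairwise_disjoint_gridReturn [Zero S] (h : ℝ≥0) :
    Pairwise (Function.onFun Disjoint (gridReturn X h)) := by
  intro i j hij
  refine Set.disjoint_left.2 fun ω hi hj => ?_
  rcases lt_or_gt_of_ne hij with h | h
  · exact hj.2 i h hi.1
  · exact hi.2 j h hj.1

/-! ### Markov property and renewal inequality on a grid -/

section

variable [MeasurableSpace Ω] {P : Measure Ω} [AddGroup S] [TopologicalSpace S] [MeasurableSpace S]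
  [DiscreteMeasurableSpace S]

lemma IsRandomWalk.measurableSet_gridReturn (hX : IsRandomWalk X P) (h : ℝ≥0) (k : ℕ) :
    MeasurableSet (gridReturn X h k) :=
  measurableSet_isFirstReturn fun j _ => hX.measurable (j * h)

lemma IsRandomWalk.measurableSet_eq_zero (hX : IsRandomWalk X P) (t : ℝ≥0) :
    MeasurableSet {ω | X t ω = 0} :=
  hX.measurable t (MeasurableSet.of_discrete (s := {0}))

variable [Countable S]

/-- The Markov property at the first return on a grid. -/
lemma IsRandomWalk.measure_gridReturn_inter (hX : IsRandomWalk X P) (h : ℝ≥0) (k : ℕ)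
    (r : ℝ≥0) :
    P (gridReturn X h k ∩ {ω | X (k * h + r) ω = 0}) =
      P (gridReturn X h k) * P {ω | X r ω = 0} := by
  -- Grid times up to step `k`, then the single time `k * h + r`: increment number `k` is the move
  -- after the return.
  let τ : ℕ → ℝ≥0 := fun i => if i ≤ k then i * h else k * h + r
  have hτ : Monotone τ := by
    refine monotone_nat_of_le_succ fun i => ?_
    simp only [τ]
    split_ifs with h1 h2 h2
    · gcongr; simp
    · refine le_add_right ?_; gcongr
    · omega
    · rfl
  have hτk : ∀ j ≤ k, τ j = j * h := fun j hj => if_pos hj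
  have hτk1 : τ (k + 1) = k * h + r := if_neg (by omega)
  let D : ℕ → Ω → S := fun i ω => X (τ (i + 1)) ω - X (τ i) ω
  have hDm : ∀ i, Measurable (D i) := fun i => by
    have : Measurable fun p : S × S => p.1 - p.2 := Measurable.of_discrete
    exact this.comp ((hX.measurable _).prodMk (hX.measurable _))
  have hD : iIndepFun D P := hX.indep_increments.nat hτ
  let m : ℕ → MeasurableSpace Ω := fun i => MeasurableSpace.comap (D i) inferInstance
  have hInd : Indep (⨆ i ∈ Set.Iio k, m i) (⨆ i ∈ ({k} : Set ℕ), m i) P :=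
    indep_iSup_of_disjoint (fun i => (hDm i).comap_le) hD (by simp)
  let Y : ℕ → Ω → S := fun j ω => pathOfIncrements (fun i => D i ω) j
  have hY : ∀ j ≤ k, Measurable[⨆ i ∈ Set.Iio k, m i] (Y j) := by
    intro j hj
    induction j with
    | zero => exact measurable_const
    | succ j ih =>
      have h1 : Measurable[⨆ i ∈ Set.Iio k, m i] (D j) :=
        (comap_measurable (D j)).mono (le_biSup m (Set.mem_Iio.2 hj)) le_rfl
      have h2 : Measurable fun p : S × S => p.1 + p.2 := Measurable.of_discrete
      exact h2.comp (h1.prodMk (ih (by omega)))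
  let A : Set Ω := {ω | IsFirstReturn (fun j => Y j ω) k}
  have hA : MeasurableSet[⨆ i ∈ Set.Iio k, m i] A := measurableSet_isFirstReturn hY
  have hC : MeasurableSet[⨆ i ∈ ({k} : Set ℕ), m i] {ω | D k ω = 0} := by
    refine le_biSup m (Set.mem_singleton k) _ ?_
    exact comap_measurable (D k) (MeasurableSet.of_discrete (s := {0}))
  -- Only almost sure, since `X 0 = 0` is.
  have hYX : ∀ᵐ ω ∂P, ∀ j ≤ k, Y j ω = X (j * h) ω := by
    filter_upwards [hX.zero] with ω hω j hj
    have := congrFun (pathOfIncrements_sub (fun i => X (τ i) ω)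
      (by simpa [hτk 0 (Nat.zero_le k)] using hω)) j
    simpa [Y, D, hτk j hj] using this
  have hAe : (gridReturn X h k : Set Ω) =ᵐ[P] A := by
    filter_upwards [hYX] with ω hω
    exact propext (isFirstReturn_congr fun j hj => (hω j hj).symm)
  have hDk : P {ω | D k ω = 0} = P {ω | X r ω = 0} := by
    have h1 := (hX.stationary_increments (k * h) r).measure_mem_eq
      (MeasurableSet.of_discrete (s := {(0 : S)}))
    simpa [D, hτk k le_rfl, hτk1, Set.preimage] using h1
  have hset : gridReturn X h k ∩ {ω | X (k * h + r) ω = 0} =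
      gridReturn X h k ∩ {ω | D k ω = 0} := by
    ext ω
    refine and_congr_right fun hω => ?_
    have h0 : X (k * h) ω = 0 := hω.1.1
    simp [D, hτk k le_rfl, hτk1, h0]
  have hAD : (gridReturn X h k ∩ {ω | D k ω = 0} : Set Ω) =ᵐ[P] (A ∩ {ω | D k ω = 0} : Set Ω) :=
    hAe.inter (ae_eq_refl _)
  rw [hset, ← hDk, measure_congr hAe, measure_congr hAD]
  exact (Indep_iff _ _ _).1 hInd _ _ hA hC

/-- Decomposition of the event `X t = 0` at the first return on a grid. -/
lemma IsRandomWalk.le_measure_eq_zero (hX : IsRandomWalk X P) (h δ : ℝ≥0) (N : ℕ) (t : ℝ≥0) :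
    (if t < δ then P {ω | ∀ s < δ, X s ω = 0} else 0) +
      ∑ k ∈ Finset.range N, (if (k : ℝ≥0) * h ≤ t then
        P (gridReturn X h k) * P {ω | X (t - k * h) ω = 0} else 0) ≤ P {ω | X t ω = 0} := by
  classical
  let s := (Finset.range N).filter fun k : ℕ => (k : ℝ≥0) * h ≤ t
  let B : Set Ω := if t < δ then {ω | ∀ s < δ, X s ω = 0} else ∅
  let A : Set Ω := ⋃ k ∈ s, gridReturn X h k ∩ {ω | X t ω = 0}
  have hAm : MeasurableSet A := s.measurableSet_biUnion fun k _ =>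
    (hX.measurableSet_gridReturn h k).inter (hX.measurableSet_eq_zero t)
  have hA : P A = ∑ k ∈ Finset.range N, (if (k : ℝ≥0) * h ≤ t then
        P (gridReturn X h k) * P {ω | X (t - k * h) ω = 0} else 0) := by
    rw [measure_biUnion_finset, Finset.sum_filter]
    · refine Finset.sum_congr rfl fun k _ => ?_
      split_ifs with hk
      · rw [← hX.measure_gridReturn_inter, add_tsub_cancel_of_le hk]
      · rfl
    · intro i _ j _ hij
      exact (pairwise_disjoint_gridReturn h hij).mono Set.inter_subset_left Set.inter_subset_left
    · exact fun k _ => (hX.measurableSet_gridReturn h k).inter (hX.measurableSet_eq_zero t)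
  have hB : P B = if t < δ then P {ω | ∀ s < δ, X s ω = 0} else 0 := by
    simp only [B]; split_ifs <;> simp
  -- A grid return by time `t < δ` needs an earlier nonzero grid value, excluded if the path
  -- vanishes on `[0, δ)`.
  have hBA : Disjoint B A := by
    refine Set.disjoint_left.2 fun ω hωB hωA => ?_
    simp only [B] at hωB
    split_ifs at hωB with ht
    · simp only [A, Set.mem_iUnion] at hωA
      obtain ⟨k, hk, hω, -⟩ := hωA
      obtain ⟨j, hj, hne⟩ := hω.1.2
      refine hne (hωB _ (lt_of_le_of_lt ?_ ht))
      refine le_trans ?_ (Finset.mem_filter.1 hk).2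
      gcongr
    · exact hωB
  rw [← hB, ← hA, ← measure_union hBA hAm]
  refine measure_mono (Set.union_subset ?_ ?_)
  · intro ω hω
    simp only [B] at hω
    split_ifs at hω with ht
    · exact hω t ht
    · exact hω.elim
  · exact Set.iUnion₂_subset fun k _ => Set.inter_subset_right

end

/-! ### Laplace transforms -/

/-- The Laplace transform of a nonnegative function on `[0, ∞)`. -/
noncomputable def laplace (l : ℝ) (f : ℝ≥0 → ℝ≥0∞) : ℝ≥0∞ :=
  ∫⁻ t in Set.Ici (0 : ℝ), ENNReal.ofReal (Real.exp (-(l * t))) * f t.toNNReal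

lemma laplace_mono {l : ℝ} {f g : ℝ≥0 → ℝ≥0∞} (h : ∀ t, f t ≤ g t) :
    laplace l f ≤ laplace l g :=
  lintegral_mono fun t => by dsimp only; gcongr; exact h _

/-- Superadditivity of the lower integral needs no measurability in `t`, and this direction
suffices. -/
lemma laplace_add_le (l : ℝ) (f g : ℝ≥0 → ℝ≥0∞) :
    laplace l f + laplace l g ≤ laplace l fun t => f t + g t := by
  unfold laplace
  simp_rw [mul_add]
  exact le_lintegral_add _ _

lemma laplace_sum_le {ι : Type*} (l : ℝ) (s : Finset ι) (f : ι → ℝ≥0 → ℝ≥0∞) :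
    ∑ i ∈ s, laplace l (f i) ≤ laplace l fun t => ∑ i ∈ s, f i t := by
  classical
  induction s using Finset.induction_on with
  | empty => simp
  | insert a s ha ih =>
    simp only [Finset.sum_insert ha]
    grw [ih, laplace_add_le]

lemma laplace_const_mul (l : ℝ) {c : ℝ≥0∞} (hc : c ≠ ∞) (f : ℝ≥0 → ℝ≥0∞) :
    laplace l (fun t => c * f t) = c * laplace l f := by
  unfold laplace
  rw [← lintegral_const_mul' _ _ hc]
  exact lintegral_congr fun t => by ring

lemma laplace_shift (l : ℝ) (s : ℝ≥0) (f : ℝ≥0 → ℝ≥0∞) :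
    laplace l (fun t => if s ≤ t then f (t - s) else 0) =
      ENNReal.ofReal (Real.exp (-(l * s))) * laplace l f := by
  unfold laplace
  beta_reduce
  rw [← lintegral_indicator measurableSet_Ici, ← lintegral_indicator measurableSet_Ici,
    ← lintegral_const_mul' _ _ ENNReal.ofReal_ne_top,
    ← lintegral_sub_right_eq_self (fun t : ℝ => ENNReal.ofReal (Real.exp (-(l * s))) *
      (Set.Ici (0 : ℝ)).indicator
        (fun t => ENNReal.ofReal (Real.exp (-(l * t))) * f t.toNNReal) t) (s : ℝ)]
  refine lintegral_congr fun t => ?_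
  by_cases hst : (s : ℝ) ≤ t
  · have ht : 0 ≤ t := s.2.trans hst
    rw [Set.indicator_of_mem (Set.mem_Ici.2 ht), Set.indicator_of_mem (by simpa using hst),
      if_pos (by rwa [Real.le_toNNReal_iff_coe_le ht]), ← mul_assoc,
      ← ENNReal.ofReal_mul (Real.exp_nonneg _), ← Real.exp_add, NNReal.sub_def,
      Real.coe_toNNReal t ht]
    congr 4
    ring
  · rw [Set.indicator_of_notMem (s := Set.Ici 0) (a := t - s) (by simpa using hst), mul_zero]
    by_cases ht : 0 ≤ t
    · rw [Set.indicator_of_mem (Set.mem_Ici.2 ht),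
        if_neg (by rwa [Real.le_toNNReal_iff_coe_le ht]), mul_zero]
    · rw [Set.indicator_of_notMem (by simpa using ht)]

lemma le_laplace_indicator {l : ℝ} (hl : l ≤ 1) (δ : ℝ≥0) (c : ℝ≥0∞) :
    ENNReal.ofReal (Real.exp (-δ)) * c * δ ≤ laplace l fun t => if t < δ then c else 0 := by
  have h : ∫⁻ _ in Set.Ico (0 : ℝ) δ, ENNReal.ofReal (Real.exp (-δ)) * c ≤
      laplace l fun t => if t < δ then c else 0 := by
    refine le_trans (setLIntegral_mono' measurableSet_Ico fun t ht => ?_)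
      (lintegral_mono_set Set.Ico_subset_Ici_self)
    beta_reduce
    rw [if_pos ((Real.toNNReal_lt_iff_lt_coe ht.1).2 ht.2)]
    gcongr
    nlinarith [ht.1, ht.2]
  simpa using h

/-- A function bounded by `1` that decays like `t ^ (ε - 1)` has a Laplace transform of order
`l ^ (-ε)` at the origin. -/
lemma laplace_le_of_le_rpow {l : ℝ} (hl : 0 < l) {ε : ℝ} (hε : 0 < ε) (t₀ : ℝ≥0)
    {f : ℝ≥0 → ℝ≥0∞} (hf : ∀ t, f t ≤ 1)
    (hf' : ∀ t ≥ t₀, f t ≤ ENNReal.ofReal ((t : ℝ) ^ (ε - 1))) :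
    laplace l f ≤ t₀ + ENNReal.ofReal ((1 / l) ^ ε * Real.Gamma ε) := by
  have h1 : ∫⁻ t in Set.Ico (0 : ℝ) t₀, ENNReal.ofReal (Real.exp (-(l * t))) * f t.toNNReal ≤
      t₀ := by
    calc _ ≤ ∫⁻ t in Set.Ico (0 : ℝ) t₀, 1 := by
          refine setLIntegral_mono' measurableSet_Ico fun t ht => ?_
          refine mul_le_one' ?_ (hf _)
          rw [ENNReal.ofReal_le_one, Real.exp_le_one_iff]
          nlinarith [mul_nonneg hl.le ht.1]
      _ = t₀ := by simp
  have hint := Real.integral_rpow_mul_exp_neg_mul_Ioi hε hl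
  have hpos : 0 < (1 / l) ^ ε * Real.Gamma ε :=
    mul_pos (by positivity) (Real.Gamma_pos_of_pos hε)
  have h2 : ∫⁻ t in Set.Ici (0 : ℝ) \ Set.Ico 0 t₀,
      ENNReal.ofReal (Real.exp (-(l * t))) * f t.toNNReal ≤
      ENNReal.ofReal ((1 / l) ^ ε * Real.Gamma ε) := by
    have hae : (Set.Ioi (0 : ℝ)) =ᵐ[volume] Set.Ici 0 := Ioi_ae_eq_Ici
    rw [← hint, ofReal_integral_eq_lintegral_ofReal
      (Integrable.of_integral_ne_zero (by rw [hint]; exact hpos.ne')),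
      setLIntegral_congr hae]
    · refine le_trans (setLIntegral_mono' (measurableSet_Ici.diff measurableSet_Ico)
        fun t ht => ?_) (lintegral_mono_set Set.sdiff_subset)
      have ht0 : 0 ≤ t := ht.1
      have ht1 : (t₀ : ℝ) ≤ t := not_lt.1 fun h => ht.2 ⟨ht0, h⟩
      have := hf' t.toNNReal ((Real.le_toNNReal_iff_coe_le ht0).2 ht1)
      rw [Real.coe_toNNReal _ ht0] at this
      rw [mul_comm (t ^ (ε - 1)), ENNReal.ofReal_mul (Real.exp_nonneg _)]
      gcongr
    · filter_upwards [ae_restrict_mem measurableSet_Ioi] with t ht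
      have : 0 < t := ht
      positivity
  unfold laplace
  rw [← lintegral_inter_add_sdiff _ _ (measurableSet_Ico (a := (0 : ℝ)) (b := (t₀ : ℝ))),
    Set.inter_eq_right.2 Set.Ico_subset_Ici_self]
  exact add_le_add h1 h2

/-! ### Laplace weights of grid returns and Fatou's lemma -/

/-- The Laplace weight `exp (- l τ)` of the first return time `τ` on the grid `h ℕ`. -/
noncomputable def gridWeight [Zero S] (X : ℝ≥0 → Ω → S) (l : ℝ) (h : ℝ≥0) (ω : Ω) : ℝ≥0∞ :=
  ∑' k : ℕ, (gridReturn X h k).indicator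
    (fun _ => ENNReal.ofReal (Real.exp (-(l * ((k * h : ℝ≥0) : ℝ))))) ω

/-- The limiting Laplace weight of the first return time along the grids `ℕ / (n + 1)`. -/
noncomputable def limitWeight [Zero S] (X : ℝ≥0 → Ω → S) (l : ℝ) (ω : Ω) : ℝ≥0∞ :=
  liminf (fun n : ℕ => gridWeight X l (1 / (n + 1)) ω) atTop

section

variable [MeasurableSpace Ω] {P : Measure Ω} [AddGroup S] [TopologicalSpace S] [MeasurableSpace S]
  [DiscreteMeasurableSpace S]

lemma IsRandomWalk.measurable_gridWeight (hX : IsRandomWalk X P) (l : ℝ) (h : ℝ≥0) :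
    Measurable (gridWeight X l h) :=
  Measurable.tsum fun k =>
    measurable_const.indicator (hX.measurableSet_gridReturn h k)

lemma IsRandomWalk.measurable_limitWeight (hX : IsRandomWalk X P) (l : ℝ) :
    Measurable (limitWeight X l) :=
  Measurable.liminf fun n => hX.measurable_gridWeight l (1 / (n + 1))

lemma IsRandomWalk.lintegral_gridWeight (hX : IsRandomWalk X P) (l : ℝ) (h : ℝ≥0) :
    ∫⁻ ω, gridWeight X l h ω ∂P =
      ∑' k : ℕ, ENNReal.ofReal (Real.exp (-(l * ((k * h : ℝ≥0) : ℝ)))) * P (gridReturn X h k) := by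
  unfold gridWeight
  rw [lintegral_tsum fun k =>
    (measurable_const.indicator (hX.measurableSet_gridReturn h k)).aemeasurable]
  exact tsum_congr fun k => lintegral_indicator_const (hX.measurableSet_gridReturn h k) _

variable [Countable S] [IsProbabilityMeasure P]

/-- The Laplace transform turns the shifts in the renewal inequality into factors; finite sums come
first, then `N → ∞`. -/
lemma IsRandomWalk.laplace_gridWeight_le (hX : IsRandomWalk X P) (l : ℝ) (h δ : ℝ≥0) :
    (laplace l fun t => if t < δ then P {ω | ∀ s < δ, X s ω = 0} else 0) +
      (∫⁻ ω, gridWeight X l h ω ∂P) * laplace l (fun t => P {ω | X t ω = 0}) ≤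
      laplace l fun t => P {ω | X t ω = 0} := by
  have key (N : ℕ) : (laplace l fun t => if t < δ then P {ω | ∀ s < δ, X s ω = 0} else 0) +
      ∑ k ∈ Finset.range N, ENNReal.ofReal (Real.exp (-(l * ((k * h : ℝ≥0) : ℝ)))) *
        P (gridReturn X h k) * laplace l (fun t => P {ω | X t ω = 0}) ≤
      laplace l fun t => P {ω | X t ω = 0} := by
    refine le_trans ?_ (laplace_mono fun t => hX.le_measure_eq_zero h δ N t)
    refine le_trans ?_ (laplace_add_le _ _ _)
    gcongr
    refine le_trans (le_of_eq ?_) (laplace_sum_le _ _ _)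
    refine Finset.sum_congr rfl fun k _ => ?_
    rw [laplace_shift l (k * h) fun t => P (gridReturn X h k) * P {ω | X t ω = 0},
      laplace_const_mul _ (measure_ne_top _ _), mul_assoc]
  rw [hX.lintegral_gridWeight, ← ENNReal.tsum_mul_right]
  refine le_of_tendsto' (tendsto_const_nhds.add ENNReal.summable.hasSum.tendsto_sum_nat) key

/-- Solving for the expected weight gives the bound `(U - G) / U`, the same for all grids, so
Fatou's lemma applies. -/
lemma IsRandomWalk.laplace_limitWeight_le (hX : IsRandomWalk X P) (l : ℝ) (δ : ℝ≥0)
    (hU : laplace l (fun t => P {ω | X t ω = 0}) ≠ ∞) :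
    (laplace l fun t => if t < δ then P {ω | ∀ s < δ, X s ω = 0} else 0) +
      (∫⁻ ω, limitWeight X l ω ∂P) * laplace l (fun t => P {ω | X t ω = 0}) ≤
      laplace l fun t => P {ω | X t ω = 0} := by
  have h0 := fun n : ℕ => hX.laplace_gridWeight_le l (1 / (n + 1)) δ
  set U := laplace l (fun t => P {ω | X t ω = 0})
  set G := laplace l fun t => if t < δ then P {ω | ∀ s < δ, X s ω = 0} else 0
  have hGU : G ≤ U := le_self_add.trans (h0 0)
  rcases eq_or_ne U 0 with hU0 | hU0
  · rw [hU0] at hGU ⊢; simpa using hGU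
  have hG : G ≠ ∞ := ne_top_of_le_ne_top hU hGU
  have h1 : ∀ n : ℕ, ∫⁻ ω, gridWeight X l (1 / (n + 1)) ω ∂P ≤ (U - G) / U := fun n => by
    rw [ENNReal.le_div_iff_mul_le (.inl hU0) (.inl hU)]
    exact ENNReal.le_sub_of_add_le_left hG (h0 n)
  have h2 : ∫⁻ ω, limitWeight X l ω ∂P ≤ (U - G) / U := by
    refine (lintegral_liminf_le (u := atTop) fun n : ℕ => hX.measurable_gridWeight l (1 / (n + 1))).trans ?_
    exact liminf_le_of_frequently_le' (Frequently.of_forall h1)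
  rw [ENNReal.le_div_iff_mul_le (.inl hU0) (.inl hU)] at h2
  grw [h2, add_tsub_cancel_of_le hGU]

end

/-! ### Comparing the limiting weight with the return time -/

lemma HasReturned.exists_isFirstReturn [Zero S] {Y : ℕ → S} {j : ℕ} (hj : HasReturned Y j) :
    ∃ k ≤ j, IsFirstReturn Y k := by
  classical
  have h : ∃ k, HasReturned Y k := ⟨j, hj⟩
  exact ⟨Nat.find h, Nat.find_min' h hj, Nat.find_spec h, fun i hi => Nat.find_min h hi⟩

lemma exp_le_gridWeight [Zero S] {l : ℝ} (hl : 0 ≤ l) {h : ℝ≥0} {ω : Ω} {j : ℕ}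
    (hj : HasReturned (fun i : ℕ => X (i * h) ω) j) :
    ENNReal.ofReal (Real.exp (-(l * ((j * h : ℝ≥0) : ℝ)))) ≤ gridWeight X l h ω := by
  obtain ⟨k, hkj, hk⟩ := hj.exists_isFirstReturn
  refine le_trans ?_ (ENNReal.le_tsum k)
  rw [Set.indicator_of_mem (show ω ∈ gridReturn X h k from hk)]
  gcongr

lemma exists_grid_mem_Ico {h : ℝ≥0} (hh : 0 < h) (t : ℝ≥0) :
    ∃ j : ℕ, (j : ℝ≥0) * h ∈ Set.Ico t (t + h) := by
  refine ⟨⌈t / h⌉₊, (div_le_iff₀ hh).1 (Nat.le_ceil _), ?_⟩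
  have := Nat.ceil_lt_add_one (zero_le (a := t / h))
  calc (⌈t / h⌉₊ : ℝ≥0) * h < (t / h + 1) * h := by gcongr
    _ = t + h := by rw [add_mul, div_mul_cancel₀ _ hh.ne', one_mul]

lemma exists_forall_Ico_eq [TopologicalSpace S] [DiscreteTopology S] {x : ℝ≥0 → S} {t : ℝ≥0}
    (hx : ContinuousWithinAt x (Set.Ici t) t) : ∃ b > t, ∀ s ∈ Set.Ico t b, x s = x t := by
  have h : ∀ᶠ s in 𝓝[≥] t, x s = x t :=
    hx (isOpen_discrete {x t} |>.mem_nhds rfl)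
  exact (mem_nhdsGE_iff_exists_Ico_subset' (lt_add_one t)).1 h

/-- By right-continuity the values at `u` and `t` persist briefly, so fine grids see both and return
by `t + 1 / (n + 1)`. -/
lemma exp_le_limitWeight [Zero S] [TopologicalSpace S] [DiscreteTopology S] {l : ℝ} (hl : 0 ≤ l)
    {ω : Ω} (hω : ∀ t, ContinuousWithinAt (fun s => X s ω) (Set.Ici t) t) {u t : ℝ≥0} (hut : u < t)
    (hu : X u ω ≠ 0) (ht : X t ω = 0) :
    ENNReal.ofReal (Real.exp (-(l * t))) ≤ limitWeight X l ω := by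
  obtain ⟨b, hb, hXb⟩ := exists_forall_Ico_eq (hω u)
  obtain ⟨c, hc, hXc⟩ := exists_forall_Ico_eq (hω t)
  have hlim : Tendsto (fun n : ℕ => (1 / (n + 1) : ℝ≥0)) atTop (𝓝 0) :=
    tendsto_one_div_add_atTop_nhds_zero_nat
  have hu' : Tendsto (fun n : ℕ => u + (1 / (n + 1) : ℝ≥0)) atTop (𝓝 u) := by
    simpa using hlim.const_add u
  have ht' : Tendsto (fun n : ℕ => t + (1 / (n + 1) : ℝ≥0)) atTop (𝓝 t) := by
    simpa using hlim.const_add t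
  have hev : ∀ᶠ n : ℕ in atTop,
      ENNReal.ofReal (Real.exp (-(l * ((t + 1 / (n + 1) : ℝ≥0) : ℝ)))) ≤
        gridWeight X l (1 / (n + 1)) ω := by
    filter_upwards [hu'.eventually_lt_const hb, hu'.eventually_lt_const hut,
      ht'.eventually_lt_const hc] with n h1 h2 h3
    have hpos : (0 : ℝ≥0) < 1 / (n + 1) := by positivity
    obtain ⟨i, hi⟩ := exists_grid_mem_Ico hpos u
    obtain ⟨j, hj⟩ := exists_grid_mem_Ico hpos t
    have hij : i < j := by
      have : (i : ℝ≥0) * (1 / (n + 1)) < j * (1 / (n + 1)) := (hi.2.trans h2).trans_le hj.1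
      exact_mod_cast lt_of_mul_lt_mul_right this hpos.le
    refine le_trans ?_ (exp_le_gridWeight hl (j := j) ⟨?_, i, hij, ?_⟩)
    · have := hj.2.le
      gcongr
    · exact (hXc _ ⟨hj.1, hj.2.trans h3⟩).trans ht
    · exact (hXb _ ⟨hi.1, hi.2.trans h1⟩).trans_ne hu
  refine le_trans (le_of_eq ?_) (liminf_le_liminf hev)
  refine (Tendsto.liminf_eq ?_).symm
  refine ENNReal.tendsto_ofReal ?_
  have : Continuous fun s : ℝ≥0 => Real.exp (-(l * (s : ℝ))) := by fun_prop
  exact (this.tendsto t).comp ht'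

lemma one_le_exp_neg_add_rpow {x ζ : ℝ} (hx : 0 ≤ x) (hζ : 0 < ζ) (hζ1 : ζ ≤ 1) :
    1 ≤ Real.exp (-x) + x ^ ζ := by
  rcases le_total 1 x with h | h
  · have := Real.one_le_rpow h hζ.le
    have := Real.exp_pos (-x)
    linarith
  · have h1 : x ≤ x ^ ζ := by
      rcases hx.eq_or_lt with rfl | hx0
      · exact Real.rpow_nonneg le_rfl _
      · simpa using Real.rpow_le_rpow_of_exponent_ge hx0 h hζ1
    have := Real.add_one_le_exp (-x)
    linarith

lemma one_le_limitWeight_add [Zero S] [TopologicalSpace S] [DiscreteTopology S]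
    {l : ℝ} (hl : 0 < l) {ζ : ℝ} (hζ : 0 < ζ) (hζ1 : ζ ≤ 1) {ω : Ω}
    (hω : ∀ t, ContinuousWithinAt (fun s => X s ω) (Set.Ici t) t) :
    1 ≤ limitWeight X l ω + ENNReal.ofReal (l ^ ζ) * returnTime X ω ^ ζ := by
  have hlζ : ENNReal.ofReal (l ^ ζ) ≠ 0 := by simpa using Real.rpow_pos_of_pos hl ζ
  rcases eq_or_ne (returnTime X ω) ∞ with hT | hT
  · simp [hT, ENNReal.top_rpow_of_pos hζ, ENNReal.mul_top hlζ]
  -- The infimum `T` need not be known to be attained: bound with return times below `y` and let `y`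
  -- decrease to `T`.
  have hlim : Tendsto (fun y : ℝ≥0∞ => limitWeight X l ω + ENNReal.ofReal (l ^ ζ) * y ^ ζ)
      (𝓝[>] (returnTime X ω)) (𝓝 (limitWeight X l ω +
        ENNReal.ofReal (l ^ ζ) * returnTime X ω ^ ζ)) :=
    ((ENNReal.Tendsto.const_mul ((ENNReal.continuous_rpow_const (y := ζ)).tendsto _)
      (.inr ENNReal.ofReal_ne_top)).const_add _).mono_left nhdsWithin_le_nhds
  have : (𝓝[>] (returnTime X ω)).NeBot := nhdsGT_neBot_of_exists_gt ⟨∞, lt_top_iff_ne_top.2 hT⟩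
  refine ge_of_tendsto hlim ?_
  filter_upwards [self_mem_nhdsWithin] with y hy
  obtain ⟨t, h⟩ := iInf_lt_iff.1 (show returnTime X ω < y from hy)
  obtain ⟨hHt, h⟩ := iInf_lt_iff.1 h
  obtain ⟨hXt, hty⟩ := iInf_lt_iff.1 h
  obtain ⟨u, h⟩ := iInf_lt_iff.1 hHt
  obtain ⟨-, h⟩ := iInf_lt_iff.1 h
  obtain ⟨hXu, hut⟩ := iInf_lt_iff.1 h
  calc (1 : ℝ≥0∞) ≤ ENNReal.ofReal (Real.exp (-(l * t)) + (l * t) ^ ζ) := by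
        rw [ENNReal.one_le_ofReal]
        exact one_le_exp_neg_add_rpow (by positivity) hζ hζ1
    _ = ENNReal.ofReal (Real.exp (-(l * t))) + ENNReal.ofReal (l ^ ζ) * (t : ℝ≥0∞) ^ ζ := by
        rw [ENNReal.ofReal_add (by positivity) (by positivity), Real.mul_rpow hl.le t.coe_nonneg,
          ENNReal.ofReal_mul (by positivity), ← ENNReal.ofReal_rpow_of_nonneg t.coe_nonneg hζ.le,
          ENNReal.ofReal_coe_nnreal]
    _ ≤ _ := by
        gcongr
        exact exp_le_limitWeight hl.le hω (by exact_mod_cast hut) hXu hXt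

/-! ### Decay against moments -/

section

variable [MeasurableSpace Ω] {P : Measure Ω} [AddGroup S] [IsProbabilityMeasure P]

lemma exists_measure_eq_zero_le_rpow {ε : ℝ}
    (h : (fun t : ℝ≥0 => transProb X P t 0 0) =o[atTop] fun t : ℝ≥0 => (t : ℝ) ^ (-1 + ε)) :
    ∃ t₀ : ℝ≥0, ∀ t ≥ t₀, P {ω | X t ω = 0} ≤ ENNReal.ofReal ((t : ℝ) ^ (ε - 1)) := by
  obtain ⟨t₀, h₀⟩ := eventually_atTop.1 (h.bound one_pos)
  refine ⟨t₀, fun t ht => ?_⟩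
  have := h₀ t ht
  rw [one_mul, transProb, Real.norm_of_nonneg measureReal_nonneg,
    Real.norm_of_nonneg (Real.rpow_nonneg t.coe_nonneg _), neg_add_eq_sub] at this
  simp only [add_zero] at this
  rw [← ofReal_measureReal]
  exact ENNReal.ofReal_le_ofReal this

variable [TopologicalSpace S] [DiscreteTopology S] [MeasurableSpace S]

lemma IsRandomWalk.exists_measure_holding_ne_zero (hX : IsRandomWalk X P) :
    ∃ δ : ℝ≥0, 0 < δ ∧ P {ω | ∀ s < δ, X s ω = 0} ≠ 0 := by
  by_contra! h
  have h0 : P (⋃ n : ℕ, {ω | ∀ s < (1 / (n + 1) : ℝ≥0), X s ω = 0}) = 0 :=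
    measure_iUnion_null fun n => h _ (by positivity)
  have h1 : ∀ᵐ ω ∂P, ω ∈ ⋃ n : ℕ, {ω | ∀ s < (1 / (n + 1) : ℝ≥0), X s ω = 0} := by
    filter_upwards [hX.zero, hX.cadlag] with ω hω hc
    obtain ⟨b, hb, hXb⟩ := exists_forall_Ico_eq (hc 0).1
    obtain ⟨n, hn⟩ := exists_nat_one_div_lt (K := ℝ) (NNReal.coe_pos.2 hb)
    refine Set.mem_iUnion.2 ⟨n, fun s hs => (hXb s ⟨zero_le, hs.trans ?_⟩).trans hω⟩
    rw [← NNReal.coe_lt_coe]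
    simpa using hn
  have h2 : ∀ᵐ ω ∂P, ω ∉ ⋃ n : ℕ, {ω | ∀ s < (1 / (n + 1) : ℝ≥0), X s ω = 0} :=
    measure_eq_zero_iff_ae_notMem.1 h0
  obtain ⟨ω, hω, hω'⟩ := (h1.and h2).exists
  exact hω' hω

variable [DiscreteMeasurableSpace S] [Countable S]

/-- Fractional moments of the return time control the Laplace transform of the return
probabilities from below. -/
lemma IsRandomWalk.laplace_holding_le (hX : IsRandomWalk X P) {l : ℝ} (hl : 0 < l) {ζ : ℝ}
    (hζ : 0 < ζ) (hζ1 : ζ ≤ 1) (δ : ℝ≥0)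
    (hU : laplace l (fun t => P {ω | X t ω = 0}) ≠ ∞) :
    (laplace l fun t => if t < δ then P {ω | ∀ s < δ, X s ω = 0} else 0) ≤
      ENNReal.ofReal (l ^ ζ) * (∫⁻ ω, returnTime X ω ^ ζ ∂P) *
        laplace l (fun t => P {ω | X t ω = 0}) := by
  have h := hX.laplace_limitWeight_le l δ hU
  have h1 : 1 ≤ (∫⁻ ω, limitWeight X l ω ∂P) +
      ENNReal.ofReal (l ^ ζ) * ∫⁻ ω, returnTime X ω ^ ζ ∂P := by
    rw [← lintegral_const_mul' _ _ ENNReal.ofReal_ne_top,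
      ← lintegral_add_left (hX.measurable_limitWeight l)]
    calc (1 : ℝ≥0∞) = ∫⁻ _, 1 ∂P := by simp
      _ ≤ _ := lintegral_mono_ae <| by
        filter_upwards [hX.cadlag] with ω hω
        exact one_le_limitWeight_add hl hζ hζ1 fun t => (hω t).1
  set U := laplace l (fun t => P {ω | X t ω = 0})
  have h2 := h.trans ((one_mul U).symm.le.trans (mul_le_mul_left h1 U))
  rw [add_mul, add_comm] at h2
  -- The cancelled term is at most `U`, hence finite.
  exact (ENNReal.add_le_add_iff_left (ne_top_of_le_ne_top hU (le_add_self.trans h))).1 h2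

lemma IsRandomWalk.lintegral_returnTime_rpow (hX : IsRandomWalk X P)
    (hdecay : ∀ ε : ℝ, 0 < ε →
      (fun t : ℝ≥0 => transProb X P t 0 0) =o[atTop] fun t : ℝ≥0 => (t : ℝ) ^ (-1 + ε))
    {ζ : ℝ} (hζ : 0 < ζ) (hζ1 : ζ ≤ 1) : ∫⁻ ω, returnTime X ω ^ ζ ∂P = ∞ := by
  by_contra hM
  set M := ∫⁻ ω, returnTime X ω ^ ζ ∂P
  obtain ⟨δ, hδ, hB⟩ := hX.exists_measure_holding_ne_zero
  -- Half of `ζ` is spent on the growth of `U`, leaving a factor `l ^ (ζ / 2)`.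
  obtain ⟨t₀, ht₀⟩ := exists_measure_eq_zero_le_rpow (hdecay (ζ / 2) (half_pos hζ))
  have hΓ : 0 < Real.Gamma (ζ / 2) := Real.Gamma_pos_of_pos (half_pos hζ)
  set c := ENNReal.ofReal (Real.exp (-δ)) * P {ω | ∀ s < δ, X s ω = 0} * δ
  have hc : c ≠ 0 := by
    simp [c, hB, hδ.ne', Real.exp_pos]
  set K := M * ENNReal.ofReal (t₀ + Real.Gamma (ζ / 2))
  have key : ∀ l : ℝ, 0 < l → l ≤ 1 → c ≤ ENNReal.ofReal (l ^ (ζ / 2)) * K := by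
    intro l hl hl1
    have hU := laplace_le_of_le_rpow hl (half_pos hζ) t₀
      (f := fun t => P {ω | X t ω = 0}) (fun t => prob_le_one) ht₀
    have hU' : laplace l (fun t => P {ω | X t ω = 0}) ≠ ∞ :=
      ne_top_of_le_ne_top (by simp) hU
    -- Absorbs `t₀` into the power of `1 / l`.
    have hpow : 1 ≤ (1 / l) ^ (ζ / 2) :=
      Real.one_le_rpow ((one_le_div hl).2 hl1) (half_pos hζ).le
    have hbd : (t₀ : ℝ≥0∞) + ENNReal.ofReal ((1 / l) ^ (ζ / 2) * Real.Gamma (ζ / 2)) ≤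
        ENNReal.ofReal ((1 / l) ^ (ζ / 2) * (t₀ + Real.Gamma (ζ / 2))) := by
      rw [← ENNReal.ofReal_coe_nnreal, ← ENNReal.ofReal_add t₀.coe_nonneg (by positivity)]
      refine ENNReal.ofReal_le_ofReal ?_
      nlinarith [mul_le_mul_of_nonneg_right hpow t₀.coe_nonneg]
    have hprod : l ^ ζ * (1 / l) ^ (ζ / 2) = l ^ (ζ / 2) := by
      rw [one_div, Real.inv_rpow hl.le, ← Real.rpow_neg hl.le, ← Real.rpow_add hl]
      congr 1; ring
    calc c ≤ _ := le_laplace_indicator hl1 δ _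
      _ ≤ _ := hX.laplace_holding_le hl hζ hζ1 δ hU'
      _ ≤ ENNReal.ofReal (l ^ ζ) * M *
          ENNReal.ofReal ((1 / l) ^ (ζ / 2) * (t₀ + Real.Gamma (ζ / 2))) := by
        gcongr
        exact hU.trans hbd
      _ = ENNReal.ofReal (l ^ (ζ / 2)) * K := by
        rw [ENNReal.ofReal_mul (by positivity), ← hprod, ENNReal.ofReal_mul (by positivity)]
        ring
  have hK : K ≠ ∞ := ENNReal.mul_ne_top hM ENNReal.ofReal_ne_top
  have hlim : Tendsto (fun l : ℝ => ENNReal.ofReal (l ^ (ζ / 2)) * K) (𝓝[>] 0) (𝓝 0) := by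
    have h1 : Tendsto (fun l : ℝ => l ^ (ζ / 2)) (𝓝[>] 0) (𝓝 0) := by
      have := (Real.continuousAt_rpow_const (0 : ℝ) (ζ / 2) (.inr (half_pos hζ).le)).tendsto
      rw [Real.zero_rpow (half_pos hζ).ne'] at this
      exact this.mono_left nhdsWithin_le_nhds
    simpa using ENNReal.Tendsto.mul_const (ENNReal.tendsto_ofReal h1) (.inr hK)
  refine hc (le_zero_iff.1 (ge_of_tendsto hlim ?_))
  filter_upwards [Ioc_mem_nhdsGT (zero_lt_one (α := ℝ))] with l hl
  exact key l hl.1 hl.2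

end

end GroupWalk

theorem mainTheorem7 {Ω S : Type*} [MeasurableSpace Ω] (P : Measure Ω) [IsProbabilityMeasure P]
    [AddGroup S] [Countable S] [TopologicalSpace S] [DiscreteTopology S]
    [MeasurableSpace S] [DiscreteMeasurableSpace S]
    (X : ℝ≥0 → Ω → S) (hX : GroupWalk.IsRandomWalk X P) (hrec : GroupWalk.IsRecurrent X P)
    (hdecay : ∀ ε : ℝ, 0 < ε →
      (fun t : ℝ≥0 => GroupWalk.transProb X P t 0 0) =o[atTop] fun t : ℝ≥0 => (t : ℝ) ^ (-1 + ε)) :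
    ∀ ζ : ℝ, 0 < ζ → ∫⁻ ω, GroupWalk.returnTime X ω ^ ζ ∂P = ∞ := by
  intro ζ hζ
  rcases le_total ζ 1 with hζ1 | hζ1
  · exact hX.lintegral_returnTime_rpow hdecay hζ hζ1
  -- Larger exponents reduce to `1` through `T ≤ 1 + T ^ ζ`.
  · have h := hX.lintegral_returnTime_rpow hdecay one_pos le_rfl
    have hle : ∫⁻ ω, GroupWalk.returnTime X ω ^ (1 : ℝ) ∂P ≤
        1 + ∫⁻ ω, GroupWalk.returnTime X ω ^ ζ ∂P := by
      calc _ ≤ ∫⁻ ω, 1 + GroupWalk.returnTime X ω ^ ζ ∂P := by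
            refine lintegral_mono fun ω => ?_
            rcases le_total (GroupWalk.returnTime X ω) 1 with h1 | h1
            · simpa using h1.trans le_self_add
            · exact (ENNReal.rpow_le_rpow_of_exponent_le h1 hζ1).trans le_add_self
        _ = _ := by rw [lintegral_add_left measurable_const]; simp
    rw [h, top_le_iff, ENNReal.add_eq_top] at hle
    exact hle.resolve_left ENNReal.one_ne_top
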